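/- All rings are associative with identity $1\neq 0$. A ring $R$ is \emph{abelian} if every idempotent of $R$ is central; \emph{reflexive} if for all $a,b\in R$, $aRb=0$ implies $bRa=0$; and \emph{semicommutative} if for all $a,b\in R$, $ab=0$ implies $aRb=0$. A \emph{minimal abelian reflexive nonsemicommutative ring} is a ring that is abelian, reflexive and not semicommutative, and whose order (cardinality) is at most that of every ring with these three properties. \textbf{Theorem.} Every minimal abelian reflexive nonsemicommutative ring has order $256$. Moreover, the group algebra $\mathbb{F}_2D_8$ of the dihedral group $D_8=\langle r,s\mid r^4=s^2=(sr)^2=1\rangle$ of order $8$ over the field with two elements is a minimal abelian reflexive nonsemicommutative ring; it is local and has order $256$. -/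

import Mathlib

/-- A ring is abelian if each of its idempotents is central. -/
def IsAbelianRing (R : Type*) [Ring R] : Prop :=
  ∀ e : R, IsIdempotentElem e → ∀ x : R, e * x = x * e

/-- A ring `R` is reflexive if `aRb = 0` implies `bRa = 0`. -/
def IsReflexiveRing (R : Type*) [Ring R] : Prop :=
  ∀ a b : R, (∀ x : R, a * x * b = 0) → ∀ x : R, b * x * a = 0

/-- A ring `R` is semicommutative if `ab = 0` implies `aRb = 0`. -/
def IsSemicommutativeRing (R : Type*) [Ring R] : Prop :=
  ∀ a b : R, a * b = 0 → ∀ x : R, a * x * b = 0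

/-- Nonzero abelian reflexive nonsemicommutative rings. The zero ring is semicommutative, so it
is excluded automatically. -/
def IsAbelianReflexiveNonsemicommutative (R : Type*) [Ring R] : Prop :=
  IsAbelianRing R ∧ IsReflexiveRing R ∧ ¬ IsSemicommutativeRing R

universe u v

/-- `R` is a minimal abelian reflexive nonsemicommutative ring: it is such a ring, and its order
(a cardinal) is at most that of any such ring `S`, finite or infinite. `R` and `S` may live in
different universes, whence the `Cardinal.lift`s. -/
def IsMinimalAbelianReflexiveNonsemicommutative (R : Type u) [Ring R] : Prop :=
  IsAbelianReflexiveNonsemicommutative R ∧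
    ∀ (S : Type v) [Ring S], IsAbelianReflexiveNonsemicommutative S →
      Cardinal.lift.{v} (Cardinal.mk R) ≤ Cardinal.lift.{u} (Cardinal.mk S)

/-- The group algebra `𝔽₂D₈` of the dihedral group of order 8 (Mathlib indexes dihedral groups by
half of their order). -/
abbrev F2D8 : Type := MonoidAlgebra (ZMod 2) (DihedralGroup 4)

/-!
A finite ring whose idempotents are central is a product of local rings, and both reflexivity and
failure of semicommutativity are detected on the factors
(`isSemicommutativeRing_of_card_lt`). It is therefore enough to show that a finite local reflexive
ring `R` with fewer than 256 elements is semicommutative. Let `J` be its radical, a nilpotent ideal,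
and `q` the order of its residue field. An element outside `J` is a unit, so `ab = 0` only has to be
considered for `a, b ∈ J`.

If `J/J²` is cyclic, then every element of `J` is a unit times a power of one element `x`, up to
higher order terms, and `ab = 0` forces the orders of `a` and `b` to add up to the nilpotency index
(`isSemicommutativeRing_of_jacobson_le_span_singleton`). Otherwise `|J/J²| ≥ q²`, and if `J² ≠ 0`
then `q⁴ ≤ |R|`, so that `q` is `2` or `3`. Then `R = ℤ + J`, and it remains to derive `acb = 0` from
`ab = 0` for `a, b, c ∈ J`. This is trivial if `J³ = 0`. If `J³ ≠ 0` and `J²/J³` is cyclic, then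
`J² = v²ℤ[v]` for some `v` (`exists_sq_le_polynomials`); by reflexivity the annihilator of `v` in `J`
is killed by `J²` on both sides, and `acb` becomes a multiple of `ab`
(`mul_mul_eq_zero_of_sq_le_polynomials`). In the remaining case `q⁶ ≤ |R|`, which leaves `q = 2`.

For `q = 2` the orders of the layers `J/J²`, `J²/J³`, … are powers of two, the first two at least
`4`, and their product is at most `2⁶`. If `J⁴ = 0`, then the subgroup of `J` killed by `J²` has
index at most `4` in `J`; by reflexivity its elements kill triple products from every position, and
so `acb` has only to be computed for a two-dimensional space of factors
(`mul_mul_eq_zero_of_pow_four_eq_bot`). If `J⁴ ≠ 0`, the layers have orders `4, 4, 2, 2`. There the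
product of four elements of `J` is a product of values of one linear form `f` on `J/J²`, and the
few positions of `a` and `b` relative to `ker f` can be treated separately
(`mul_mul_eq_zero_of_pow_five_eq_bot`).

The group algebra `𝔽₂D₈` is reflexive because the coefficient of the identity is a nondegenerate
symmetric trace, and local, hence abelian, because `D₈` is a `2`-group: a nontrivial left ideal of
the group algebra contains a nonzero vector fixed by the group. For a reflection `s` one has
`(1 + s)² = 0`, but `(1 + s) r (1 + s) ≠ 0` for a rotation `r` of order four.
-/

/-! ### Powers of a two-sided ideal -/

theorem mul_mem_ideal_pow {R : Type*} [Ring R] {J : Ideal R} [J.IsTwoSided] {m n k : ℕ} {x y : R}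
    (hx : x ∈ J ^ m) (hy : y ∈ J ^ n) (h : k ≤ m + n) : x * y ∈ J ^ k :=
  Ideal.pow_le_pow_right h (Ideal.IsTwoSided.pow_add (I := J) m n ▸ Ideal.mul_mem_mul hx hy)

theorem mem_pow_one {R : Type*} [Ring R] {J : Ideal R} {x : R} (hx : x ∈ J) : x ∈ J ^ 1 := by
  rwa [Submodule.pow_one]

theorem exists_mul_notMem {R : Type*} [Ring R] {I J : Ideal R} {K : AddSubgroup R} {t : R}
    (ht : t ∈ I * J) (htK : t ∉ K) : ∃ x ∈ I, ∃ y ∈ J, x * y ∉ K := by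
  by_contra! H
  exact htK (Submodule.smul_induction_on ht H fun _ _ => K.add_mem)

theorem pow_succ_lt_of_ne_bot {R : Type*} [Ring R] {J : Ideal R} [J.IsTwoSided]
    (hnil : IsNilpotent J) {k : ℕ} (hk : J ^ k ≠ ⊥) : J ^ (k + 1) < J ^ k := by
  refine lt_of_le_of_ne (Ideal.pow_le_pow_right k.le_succ) fun h => hk ?_
  obtain ⟨N, hN⟩ := hnil
  have key : ∀ n, J ^ (k + n) = J ^ k := by
    intro n
    induction n with
    | zero => rfl
    | succ n ih => rw [← add_assoc, Ideal.IsTwoSided.pow_succ, ih, ← Ideal.IsTwoSided.pow_succ, h]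
  rw [← key N]
  exact le_bot_iff.1 ((Ideal.pow_le_pow_right (Nat.le_add_left N k)).trans_eq hN)

/-! ### Radicals whose square is generated by powers of one element -/

open Polynomial in
/-- Every element of `J` is a polynomial in `v` plus an element `z` with `vz = 0`. Such a `z` is
killed by left multiplication by `J²`, hence by reflexivity also by right multiplication, so that
only the polynomial parts contribute to triple products. -/
theorem mul_mul_eq_zero_of_sq_le_polynomials {R : Type*} [Ring R] (hR : IsReflexiveRing R)
    {J : Ideal R} [J.IsTwoSided] {v : R} (hv : v ∈ J)
    (hJ : ∀ x ∈ J ^ 2, ∃ p : ℤ[X], x = aeval v (X ^ 2 * p))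
    {a b c : R} (ha : a ∈ J) (hb : b ∈ J) (hc : c ∈ J) (hab : a * b = 0) : a * c * b = 0 := by
  have comm : ∀ p q : ℤ[X], aeval v p * aeval v q = aeval v q * aeval v p := fun p q => by
    rw [← map_mul, mul_comm, map_mul]
  have dec : ∀ y ∈ J, ∃ p : ℤ[X], ∃ z ∈ J, y = aeval v (X * p) + z ∧ v * z = 0 := by
    intro y hy
    obtain ⟨p, hp⟩ := hJ (v * y) (mul_mem_ideal_pow (mem_pow_one hv) (mem_pow_one hy) le_rfl)
    have hX : aeval v (X * p) = aeval v p * v := by rw [mul_comm]; simp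
    refine ⟨p, y - aeval v (X * p), J.sub_mem hy (hX ▸ J.mul_mem_left _ hv), by abel, ?_⟩
    rw [mul_sub, hp, pow_two, mul_assoc, map_mul, aeval_X, sub_self]
  have left : ∀ z, v * z = 0 → ∀ x ∈ J ^ 2, x * z = 0 := by
    intro z hz x hx
    obtain ⟨p, rfl⟩ := hJ x hx
    rw [mul_comm, pow_two, ← mul_assoc, map_mul, aeval_X, mul_assoc, hz, mul_zero]
  have right : ∀ z, v * z = 0 → ∀ x ∈ J ^ 2, z * x = 0 := by
    intro z hz x hx
    simpa using hR x z (fun r => left z hz _ (Ideal.mul_mem_right _ _ hx)) 1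
  have sq : ∀ x ∈ J, ∀ y ∈ J, x * y ∈ J ^ 2 := fun x hx y hy =>
    mul_mem_ideal_pow (mem_pow_one hx) (mem_pow_one hy) le_rfl
  obtain ⟨p, y, hy, rfl, hvy⟩ := dec a ha
  obtain ⟨q, z, hz, rfl, hvz⟩ := dec b hb
  obtain ⟨r, w, hw, rfl, hvw⟩ := dec c hc
  have mem : ∀ t : ℤ[X], aeval v (X * t) ∈ J := fun t => by
    rw [mul_comm, map_mul, aeval_X]; exact J.mul_mem_left _ hv
  have kill : ∀ (t : ℤ[X]) u, v * u = 0 → aeval v (X * t) * u = 0 := fun t u hu => by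
    rw [mul_comm, map_mul, aeval_X, mul_assoc, hu, mul_zero]
  -- Both `a c b` and `r (a b)` reduce to the product of the three polynomial parts.
  have h1 : (aeval v (X * p) + y) * (aeval v (X * r) + w) * (aeval v (X * q) + z) =
      aeval v (X * p) * aeval v (X * r) * aeval v (X * q) := by
    rw [mul_add _ _ z, left z hvz _ (sq _ ha _ hc), add_zero, add_mul, add_mul, mul_assoc y,
      right y hvy _ (sq _ hc _ (mem q)), add_zero, mul_add, kill p w hvw, add_zero]
  have h2 : aeval v (X * r) * ((aeval v (X * p) + y) * (aeval v (X * q) + z)) =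
      aeval v (X * r) * aeval v (X * p) * aeval v (X * q) := by
    rw [← mul_assoc, mul_add _ _ y, kill r y hvy, add_zero, mul_add,
      left z hvz _ (sq _ (mem r) _ (mem p)), add_zero]
  rw [h1, comm (X * p), ← h2, hab, mul_zero]

/-- If `J² / J³` is cyclic and `J³ ≠ 0`, the multiplication `J/J² × J/J² → J²/J³` is, up
to a scalar, the square of a linear form, and any `v` on which the form does not vanish has
`J² = v² ℤ[v]`. -/
theorem exists_sq_le_polynomials {R : Type*} [Ring R] {J : Ideal R} [J.IsTwoSided]
    (hnil : IsNilpotent J) (h3 : J ^ 3 ≠ ⊥)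
    (hu : ∀ u ∈ J ^ 2, u ∉ J ^ 3 → ∀ x ∈ J ^ 2, ∃ n : ℤ, x - n * u ∈ J ^ 3) :
    ∃ v ∈ J, ∀ x ∈ J ^ 2, ∃ p : Polynomial ℤ, x = Polynomial.aeval v (Polynomial.X ^ 2 * p) := by
  have sq : ∀ x ∈ J, ∀ y ∈ J, x * y ∈ J ^ 2 := fun x hx y hy =>
    mul_mem_ideal_pow (mem_pow_one hx) (mem_pow_one hy) le_rfl
  have three : ∀ x ∈ J, ∀ y ∈ J ^ 3, x * y ∈ J ^ 4 := fun x hx y hy =>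
    mul_mem_ideal_pow (mem_pow_one hx) hy le_rfl
  have three' : ∀ x ∈ J, ∀ y ∈ J ^ 3, y * x ∈ J ^ 4 := fun x hx y hy =>
    mul_mem_ideal_pow hy (mem_pow_one hx) le_rfl
  obtain ⟨w, hw, hw4⟩ := SetLike.exists_of_lt (pow_succ_lt_of_ne_bot hnil h3)
  rw [Ideal.IsTwoSided.pow_succ] at hw
  obtain ⟨x, hx, t, ht, hxt⟩ := exists_mul_notMem (K := (J ^ 4).toAddSubgroup) hw hw4
  have ht3 : t ∉ J ^ 3 := fun h => hxt (three x hx t h)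
  obtain ⟨y, hy, z, hz, hyz⟩ : ∃ y ∈ J, ∃ z ∈ J, y * z ∉ J ^ 3 := by
    have ht' := ht
    rw [Ideal.IsTwoSided.pow_succ, Submodule.pow_one] at ht'
    exact exists_mul_notMem (K := (J ^ 3).toAddSubgroup) ht' ht3
  -- Congruence modulo `J³` lets `t` be replaced by a multiple of `u`, for any `u ∈ J² \ J³`.
  have repl : ∀ s ∈ J ^ 2, x * s ∉ J ^ 4 → ∀ u ∈ J ^ 2, u ∉ J ^ 3 → x * u ∉ J ^ 4 := by
    intro s hs hxs u hu2 hu3 hxu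
    obtain ⟨n, hn⟩ := hu u hu2 hu3 s hs
    apply hxs
    have h := (J ^ 4).add_mem (three x hx _ hn) ((J ^ 4).mul_mem_left (n : R) hxu)
    have e : x * (s - n * u) + n * (x * u) = x * s := by
      rw [mul_sub, ← mul_assoc x, ← (Int.cast_commute n x).eq]; noncomm_ring
    rwa [e] at h
  have hxyz := repl t ht hxt _ (sq y hy z hz) hyz
  have hxy : x * y ∉ J ^ 3 := fun h => hxyz (by rw [← mul_assoc]; exact three' z hz _ h)
  have hxxy := repl t ht hxt _ (sq x hx y hy) hxy
  have hxx : x * x ∉ J ^ 3 := fun h => hxxy (by rw [← mul_assoc]; exact three' y hy _ h)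
  have step : ∀ k, ∀ w ∈ J ^ (k + 2), ∃ n : ℤ, w - n * x ^ (k + 2) ∈ J ^ (k + 3) := by
    intro k
    induction k with
    | zero => intro w hw; rw [pow_two]; exact hu _ (sq x hx x hx) hxx w hw
    | succ k ih =>
      intro w hw
      rw [show k + 1 + 2 = (k + 2) + 1 by ring, Ideal.IsTwoSided.pow_succ] at hw
      induction hw using Submodule.smul_induction_on' with
      | smul r hr s hs =>
        obtain ⟨n, hn⟩ := ih s hs
        obtain ⟨m, hm⟩ := hu _ (sq x hx x hx) hxx _ (sq r hr x hx)
        refine ⟨n * m, ?_⟩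
        have h1 : r * (s - n * x ^ (k + 2)) ∈ J ^ (k + 1 + 3) :=
          mul_mem_ideal_pow (mem_pow_one hr) hn (by omega)
        have h2 : (r * x - m * (x * x)) * x ^ (k + 1) ∈ J ^ (k + 1 + 3) :=
          mul_mem_ideal_pow hm (Ideal.pow_mem_pow hx _) (by omega)
        have h := (J ^ (k + 1 + 3)).add_mem h1 ((J ^ (k + 1 + 3)).mul_mem_left (n : R) h2)
        have e : r * (s - n * x ^ (k + 2)) + n * ((r * x - m * (x * x)) * x ^ (k + 1)) =
            r * s - ((n * m : ℤ) : R) * x ^ (k + 1 + 2) := by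
          rw [mul_sub, ← mul_assoc r, ← (Int.cast_commute n r).eq, sub_mul, mul_sub,
            show x ^ (k + 2) = x * x ^ (k + 1) from pow_succ' _ _,
            show x ^ (k + 1 + 2) = x * (x * x ^ (k + 1)) by rw [← pow_succ', ← pow_succ']]
          push_cast
          noncomm_ring
        rw [e] at h
        simpa using h
      | add a _ b _ ha hb =>
        obtain ⟨n, hn⟩ := ha
        obtain ⟨m, hm⟩ := hb
        refine ⟨n + m, ?_⟩
        have h := (J ^ (k + 1 + 3)).add_mem hn hm
        rwa [show a - n * x ^ (k + 1 + 2) + (b - m * x ^ (k + 1 + 2)) =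
          a + b - ((n + m : ℤ) : R) * x ^ (k + 1 + 2) by push_cast; noncomm_ring] at h
  have approx : ∀ w ∈ J ^ 2, ∀ d, ∃ p : Polynomial ℤ,
      w - Polynomial.aeval x (Polynomial.X ^ 2 * p) ∈ J ^ (d + 2) := by
    intro w hw d
    induction d with
    | zero => exact ⟨0, by simpa using hw⟩
    | succ d ih =>
      obtain ⟨p, hp⟩ := ih
      obtain ⟨n, hn⟩ := step d _ hp
      refine ⟨p + Polynomial.C n * Polynomial.X ^ d, ?_⟩
      have e : w - Polynomial.aeval x (Polynomial.X ^ 2 * p) - n * x ^ (d + 2) =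
          w - Polynomial.aeval x
            (Polynomial.X ^ 2 * (p + Polynomial.C n * Polynomial.X ^ d)) := by
        rw [show (Polynomial.X : Polynomial ℤ) ^ 2 * (p + Polynomial.C n * Polynomial.X ^ d) =
          Polynomial.X ^ 2 * p + Polynomial.C n * Polynomial.X ^ (d + 2) by ring]
        simp [sub_sub]
      rwa [e] at hn
  refine ⟨x, hx, fun w hw => ?_⟩
  obtain ⟨N, hN⟩ := hnil
  obtain ⟨p, hp⟩ := approx w hw N
  have : w - Polynomial.aeval x (Polynomial.X ^ 2 * p) ∈ (⊥ : Ideal R) :=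
    ((Ideal.pow_le_pow_right (by omega)).trans_eq hN) hp
  exact ⟨p, sub_eq_zero.1 ((Submodule.mem_bot R).1 this)⟩

/-! ### Counting in chains of additive subgroups -/

theorem AddSubgroup.two_mul_card_le_of_lt {G : Type*} [AddGroup G] [Finite G]
    {A B : AddSubgroup G} (h : A < B) : 2 * Nat.card A ≤ Nat.card B := by
  obtain ⟨k, hk⟩ := AddSubgroup.card_dvd_of_le h.le
  have hA : 0 < Nat.card A := Nat.card_pos
  have hne : Nat.card A ≠ Nat.card B := fun e =>
    h.ne (SetLike.coe_injective (Set.eq_of_subset_of_ncard_le h.le e.ge (Set.toFinite _)))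
  have hB : 0 < Nat.card B := Nat.card_pos
  have : 2 ≤ k := by
    rcases k with _ | _ | k
    · simp at hk; omega
    · simp at hk; omega
    · omega
  rw [hk, mul_comm]
  exact Nat.mul_le_mul_left _ this

/-- In a chain `A ≤ B` of index less than four there is no room for a subgroup strictly in
between. -/
theorem AddSubgroup.eq_of_lt_of_le_of_card_lt {G : Type*} [AddGroup G] [Finite G]
    {A B C : AddSubgroup G} (hAB : A < B) (hBC : B ≤ C) (h : Nat.card C < 4 * Nat.card A) :
    B = C := by
  by_contra hne
  have h1 := two_mul_card_le_of_lt hAB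
  have h2 := two_mul_card_le_of_lt (lt_of_le_of_ne hBC hne)
  omega

theorem AddSubgroup.lt_sup_zmultiples {G : Type*} [AddCommGroup G] {A : AddSubgroup G} {x : G}
    (hx : x ∉ A) : A < A ⊔ zmultiples x :=
  left_lt_sup.2 fun h => hx (h (mem_zmultiples x))

theorem AddSubgroup.exists_zsmul_of_mem_sup {G : Type*} [AddCommGroup G] {A : AddSubgroup G}
    {x y : G} (hy : y ∈ A ⊔ zmultiples x) : ∃ z ∈ A, ∃ n : ℤ, y = z + n • x := by
  obtain ⟨z, hz, w, hw, rfl⟩ := mem_sup.1 hy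
  obtain ⟨n, rfl⟩ := mem_zmultiples_iff.1 hw
  exact ⟨z, hz, n, rfl⟩

theorem AddSubgroup.sub_mem_of_card_le_two_mul {G : Type*} [AddCommGroup G] [Finite G]
    {A B : AddSubgroup G} (hAB : A ≤ B) (h : Nat.card B ≤ 2 * Nat.card A) {x y : G}
    (hx : x ∈ B) (hy : y ∈ B) (hxA : x ∉ A) (hyA : y ∉ A) : x - y ∈ A := by
  have hA : 0 < Nat.card A := Nat.card_pos
  have hmul : A.relIndex B * Nat.card A = Nat.card B := by
    rw [← (A.addSubgroupOf B).card_mul_index, mul_comm,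
      Nat.card_congr (addSubgroupOfEquivOfLe hAB).toEquiv]
    rfl
  have h0 : A.relIndex B ≤ 2 := by
    by_contra! hlt
    have := Nat.mul_le_mul_right (Nat.card A) hlt
    omega
  have h1 : A.relIndex B ≠ 1 := fun e => hxA (relIndex_eq_one.1 e hx)
  have h2 : A.relIndex B ≠ 0 := fun e => by
    have : 0 < Nat.card B := Nat.card_pos
    rw [e, zero_mul] at hmul; omega
  have h3 : (A.addSubgroupOf B).index = 2 := by
    change A.relIndex B = 2; omega
  have := (AddSubgroup.add_mem_iff_of_index_two h3 (a := ⟨x, hx⟩) (b := -⟨y, hy⟩))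
  simp only [mem_addSubgroupOf, neg_mem_iff, hxA, hyA, iff_true] at this
  simpa [sub_eq_add_neg] using this

theorem AddSubgroup.card_le_card_mul_card_inf_ker {G H : Type*} [AddGroup G] [AddGroup H]
    [Finite G] [Finite H] (A : AddSubgroup G) (B : AddSubgroup H) (φ : G →+ H)
    (h : ∀ x ∈ A, φ x ∈ B) :
    Nat.card A ≤ Nat.card B * Nat.card (A ⊓ φ.ker : AddSubgroup G) := by
  let ψ : A →+ B := (φ.comp A.subtype).codRestrict B fun x => h x x.2
  have h1 := ψ.ker.card_mul_index
  have h2 : ψ.ker.index ≤ Nat.card B := by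
    rw [AddSubgroup.index_ker]
    exact Nat.card_le_card_of_injective _ Subtype.val_injective
  have h3 : Nat.card ψ.ker ≤ Nat.card (A ⊓ φ.ker : AddSubgroup G) :=
    Nat.card_le_card_of_injective (fun x => ⟨x.1.1, x.1.2, congrArg Subtype.val x.2⟩)
      fun x y hxy => Subtype.ext (Subtype.ext (Subtype.mk.inj hxy))
  rw [← h1, mul_comm]
  exact Nat.mul_le_mul h2 h3

theorem card_eq_two_pow_of_isNilpotent_two {R : Type*} [Ring R] [Finite R]
    (h : IsNilpotent (2 : R)) : ∃ k, Nat.card R = 2 ^ k := by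
  obtain ⟨N, hN⟩ := h
  refine ⟨_, Nat.eq_prime_pow_of_unique_prime_dvd Nat.card_pos.ne' fun {p} hp hdvd => ?_⟩
  have := Fintype.ofFinite R
  have := Fact.mk hp
  rw [Nat.card_eq_fintype_card] at hdvd
  obtain ⟨x, hx⟩ := exists_prime_addOrderOf_dvd_card p hdvd
  have h2 : 2 ^ N • x = 0 := by
    rw [nsmul_eq_mul, Nat.cast_pow, Nat.cast_ofNat, hN, zero_mul]
  have := addOrderOf_dvd_of_nsmul_eq_zero h2
  rw [hx] at this
  exact (Nat.prime_dvd_prime_iff_eq hp Nat.prime_two).1 (hp.dvd_of_dvd_pow this)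

/-! ### Radicals with vanishing fourth power -/

/-- The additive subgroup of those elements of an ideal `J` which are killed by `J²` from the
left. -/
def sqRightAnnihilator {R : Type*} [Ring R] (J : Ideal R) : AddSubgroup R where
  carrier := {z | z ∈ J ∧ ∀ u ∈ J ^ 2, u * z = 0}
  zero_mem' := ⟨J.zero_mem, by simp⟩
  add_mem' := fun ⟨hx, hx'⟩ ⟨hy, hy'⟩ =>
    ⟨J.add_mem hx hy, fun u hu => by rw [mul_add, hx' u hu, hy' u hu, add_zero]⟩
  neg_mem' := fun ⟨hx, hx'⟩ => ⟨J.neg_mem hx, fun u hu => by rw [mul_neg, hx' u hu, neg_zero]⟩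

/-- Let `Z` be the annihilator of `J²` in `J`. Since its index is less than `8`, the classes modulo
`Z` of `a`, `b` and `c` satisfy a linear relation, triangular in this order. If `a` and `b` are
independent, `c` is a combination of them and `acb = 0` directly; if `b ≡ na`, then `(na)aJ = 0`,
and reflexivity gives `(ac)(na) = 0`. -/
theorem mul_mul_eq_zero_of_pow_four_eq_bot {R : Type*} [Ring R] [Finite R]
    (hR : IsReflexiveRing R) {J : Ideal R} [J.IsTwoSided] (hres : ∀ r : R, ∃ n : ℤ, r - n ∈ J)
    (h4 : J ^ 4 = ⊥)
    (hcard : Nat.card J.toAddSubgroup < 8 * Nat.card (sqRightAnnihilator J))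
    {a b c : R} (ha : a ∈ J) (hb : b ∈ J) (hc : c ∈ J) (hab : a * b = 0) : a * c * b = 0 := by
  have zero : ∀ x ∈ J ^ 4, x = 0 := fun x hx => by rwa [h4, Submodule.mem_bot] at hx
  have four : ∀ x ∈ J, ∀ y ∈ J, ∀ z ∈ J, ∀ w ∈ J, x * y * (z * w) = 0 := fun x hx y hy z hz w hw =>
    zero _ (mul_mem_ideal_pow (mul_mem_ideal_pow (mem_pow_one hx) (mem_pow_one hy) le_rfl)
      (mul_mem_ideal_pow (mem_pow_one hz) (mem_pow_one hw) le_rfl) le_rfl)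
  have sq : ∀ x ∈ J, ∀ y ∈ J, x * y ∈ J ^ 2 := fun x hx y hy =>
    mul_mem_ideal_pow (mem_pow_one hx) (mem_pow_one hy) le_rfl
  -- By reflexivity the elements of the annihilator kill triple products from any position.
  have right : ∀ z ∈ sqRightAnnihilator J, ∀ u ∈ J ^ 2, z * u = 0 := fun z hz u hu => by
    simpa using hR u z (fun r => hz.2 _ (Ideal.mul_mem_right _ _ hu)) 1
  have mid : ∀ z ∈ sqRightAnnihilator J, ∀ x ∈ J, ∀ y ∈ J, x * z * y = 0 := fun z hz x hx y hy => by
    simpa using hR y (x * z)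
      (fun r => by rw [← mul_assoc]; exact hz.2 _ (sq _ (J.mul_mem_right _ hy) _ hx)) 1
  by_cases haZ : a ∈ sqRightAnnihilator J
  · rw [mul_assoc]; exact right a haZ _ (sq c hc b hb)
  have hZJ : sqRightAnnihilator J ≤ J.toAddSubgroup := fun z hz => hz.1
  have haJ : sqRightAnnihilator J ⊔ AddSubgroup.zmultiples a ≤ J.toAddSubgroup :=
    sup_le hZJ (by simpa using ha)
  have hbJ : sqRightAnnihilator J ⊔ AddSubgroup.zmultiples a ⊔ AddSubgroup.zmultiples b ≤
      J.toAddSubgroup := sup_le haJ (by simpa using hb)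
  have h1 := AddSubgroup.two_mul_card_le_of_lt (AddSubgroup.lt_sup_zmultiples haZ)
  by_cases hbZ : b ∈ sqRightAnnihilator J ⊔ AddSubgroup.zmultiples a
  · obtain ⟨z, hz, n, rfl⟩ := AddSubgroup.exists_zsmul_of_mem_sup hbZ
    have haa : ∀ x ∈ J, n • (a * a * x) = 0 := fun x hx => by
      have : a * (z + n • a) * x = a * z * x + n • (a * a * x) := by noncomm_ring
      rwa [hab, zero_mul, mid z hz a ha x hx, zero_add, eq_comm] at this
    have key := hR (n • a) (a * c) (fun r => by
      obtain ⟨m, hm⟩ := hres r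
      have : n • a * r * (a * c) = n • (a * (r - m) * (a * c)) + m • n • (a * a * c) := by
        rw [mul_sub, ← (Int.cast_commute m a).eq]
        simp only [← zsmul_eq_mul, sub_mul, smul_sub, smul_mul_assoc, mul_assoc, smul_comm n m]
        abel
      rw [this, four a ha _ hm a ha c hc, haa c hc, smul_zero, smul_zero, add_zero]) 1
    rw [mul_add, hz.2 _ (sq a ha c hc), zero_add]
    simpa using key
  have h2 := AddSubgroup.two_mul_card_le_of_lt (AddSubgroup.lt_sup_zmultiples hbZ)
  have hcZ : c ∈ sqRightAnnihilator J ⊔ AddSubgroup.zmultiples a ⊔ AddSubgroup.zmultiples b := by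
    have h3 := hbJ.lt_or_eq.resolve_left fun h => by
      have := AddSubgroup.two_mul_card_le_of_lt h
      omega
    rw [h3]; exact hc
  obtain ⟨w, hw, m, rfl⟩ := AddSubgroup.exists_zsmul_of_mem_sup hcZ
  obtain ⟨z, hz, n, rfl⟩ := AddSubgroup.exists_zsmul_of_mem_sup hw
  have : a * (z + n • a + m • b) * b = a * z * b + n • (a * (a * b)) + m • (a * b * b) := by
    noncomm_ring
  rw [this, hab, mid z hz a ha b hb]
  simp

/-- When `J⁴ = 0`, the annihilator in `J` of two generators of `J²` modulo `J³` is the annihilator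
of `J²`. -/
theorem card_le_card_sq_mul_card_sqRightAnnihilator {R : Type*} [Ring R] [Finite R] {J : Ideal R}
    [J.IsTwoSided] (h4 : J ^ 4 = ⊥)
    (hc : Nat.card (J ^ 2).toAddSubgroup < 8 * Nat.card (J ^ 3).toAddSubgroup) :
    Nat.card J.toAddSubgroup ≤
      Nat.card (J ^ 3).toAddSubgroup ^ 2 * Nat.card (sqRightAnnihilator J) := by
  obtain ⟨u, hu, w, hw, huw⟩ : ∃ u ∈ J ^ 2, ∃ w ∈ J ^ 2, (J ^ 2).toAddSubgroup ≤
      (J ^ 3).toAddSubgroup ⊔ AddSubgroup.zmultiples u ⊔ AddSubgroup.zmultiples w := by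
    by_contra! H
    have h0 : (J ^ 3).toAddSubgroup ≤ (J ^ 2).toAddSubgroup :=
      fun x hx => Ideal.pow_le_pow_right (by norm_num) hx
    have H0 := H 0 (zero_mem _) 0 (zero_mem _)
    obtain ⟨u, hu, hu'⟩ := SetLike.not_le_iff_exists.1 H0
    have H1 := H u hu 0 (zero_mem _)
    obtain ⟨w, hw, hw'⟩ := SetLike.not_le_iff_exists.1 H1
    simp only [AddSubgroup.zmultiples_zero_eq_bot, sup_bot_eq] at hu' hw'
    have l1 := AddSubgroup.two_mul_card_le_of_lt (AddSubgroup.lt_sup_zmultiples hu')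
    have l2 := AddSubgroup.two_mul_card_le_of_lt (AddSubgroup.lt_sup_zmultiples hw')
    have l3 : (J ^ 3).toAddSubgroup ⊔ AddSubgroup.zmultiples u ⊔ AddSubgroup.zmultiples w <
        (J ^ 2).toAddSubgroup :=
      lt_of_le_not_ge (sup_le (sup_le h0 (by simpa using hu)) (by simpa using hw)) (H u hu w hw)
    have l4 := AddSubgroup.two_mul_card_le_of_lt l3
    omega
  have hJ3 : ∀ t ∈ J ^ 2, ∀ x ∈ J.toAddSubgroup,
      AddMonoidHom.mulLeft t x ∈ (J ^ 3).toAddSubgroup :=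
    fun t ht x hx => mul_mem_ideal_pow ht (mem_pow_one hx) le_rfl
  have c1 := AddSubgroup.card_le_card_mul_card_inf_ker _ _ _ (hJ3 u hu)
  have c2 := AddSubgroup.card_le_card_mul_card_inf_ker
    (J.toAddSubgroup ⊓ (AddMonoidHom.mulLeft u).ker) _ _ fun x hx => hJ3 w hw x hx.1
  have c3 : J.toAddSubgroup ⊓ (AddMonoidHom.mulLeft u).ker ⊓ (AddMonoidHom.mulLeft w).ker ≤
      sqRightAnnihilator J := by
    rintro z ⟨⟨hz, hzu⟩, hzw⟩
    refine ⟨hz, fun t ht => ?_⟩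
    obtain ⟨s, hs, m, rfl⟩ := AddSubgroup.exists_zsmul_of_mem_sup (huw ht)
    obtain ⟨r, hr, n, rfl⟩ := AddSubgroup.exists_zsmul_of_mem_sup hs
    have hrz : r * z ∈ J ^ 4 := mul_mem_ideal_pow hr (mem_pow_one hz) le_rfl
    rw [h4, Submodule.mem_bot] at hrz
    have h1 : u * z = 0 := hzu
    have h2 : w * z = 0 := hzw
    simp [add_mul, mul_assoc, hrz, h1, h2]
  calc _ ≤ _ := c1
    _ ≤ _ := Nat.mul_le_mul_left _ (c2.trans (Nat.mul_le_mul_left _ (AddSubgroup.card_le_of_le c3)))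
    _ = _ := by ring

/-! ### Radicals with vanishing fifth power -/

/-- Reflexivity is not needed here. The quartic form `J/J² → J⁴` is `f ⊗ f ⊗ f ⊗ f` for a linear
form `f`. By `ab = 0` the form `f` vanishes on `a` or on `b`. If on one of them only, then `acb = 0`,
since multiples of `a` and `b` may be subtracted from `c`. If on both and `acb ≠ 0`, then `a ≡ b`
modulo `J²` and `ava ≠ 0` for any `v` with `f(v) ≠ 0`, which makes `v²`, `va` and `av` independent
in the layer `J²/J³` of order four. -/
theorem mul_mul_eq_zero_of_pow_five_eq_bot {R : Type*} [Ring R] [Finite R]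
    {J : Ideal R} [J.IsTwoSided] (h5 : J ^ 5 = ⊥) (h4 : J ^ 4 ≠ ⊥)
    (hc1 : Nat.card J.toAddSubgroup ≤ 4 * Nat.card (J ^ 2).toAddSubgroup)
    (hc2 : Nat.card (J ^ 2).toAddSubgroup ≤ 4 * Nat.card (J ^ 3).toAddSubgroup)
    (hc3 : Nat.card (J ^ 3).toAddSubgroup ≤ 2 * Nat.card (J ^ 4).toAddSubgroup)
    (hc4 : Nat.card (J ^ 4).toAddSubgroup ≤ 2)
    {a b c : R} (ha : a ∈ J) (hb : b ∈ J) (hc : c ∈ J) (hab : a * b = 0) : a * c * b = 0 := by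
  have zero : ∀ x ∈ J ^ 5, x = 0 := fun x hx => by rwa [h5, Submodule.mem_bot] at hx
  have m2 : ∀ x ∈ J, ∀ y ∈ J, x * y ∈ J ^ 2 := fun x hx y hy =>
    mul_mem_ideal_pow (mem_pow_one hx) (mem_pow_one hy) le_rfl
  have m12 : ∀ x ∈ J, ∀ y ∈ J ^ 2, x * y ∈ J ^ 3 := fun x hx y hy =>
    mul_mem_ideal_pow (mem_pow_one hx) hy le_rfl
  have m21 : ∀ x ∈ J ^ 2, ∀ y ∈ J, x * y ∈ J ^ 3 := fun x hx y hy =>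
    mul_mem_ideal_pow hx (mem_pow_one hy) le_rfl
  have m3 : ∀ x ∈ J, ∀ y ∈ J, ∀ z ∈ J, x * y * z ∈ J ^ 3 := fun x hx y hy z hz =>
    m21 _ (m2 x hx y hy) z hz
  have m31 : ∀ x ∈ J ^ 3, ∀ y ∈ J, x * y ∈ J ^ 4 := fun x hx y hy =>
    mul_mem_ideal_pow hx (mem_pow_one hy) le_rfl
  have z14 : ∀ x ∈ J, ∀ y ∈ J ^ 4, x * y = 0 := fun x hx y hy =>
    zero _ (mul_mem_ideal_pow (mem_pow_one hx) hy le_rfl)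
  have z41 : ∀ x ∈ J ^ 4, ∀ y ∈ J, x * y = 0 := fun x hx y hy =>
    zero _ (mul_mem_ideal_pow hx (mem_pow_one hy) le_rfl)
  have z23 : ∀ x ∈ J ^ 2, ∀ y ∈ J ^ 3, x * y = 0 := fun x hx y hy =>
    zero _ (mul_mem_ideal_pow hx hy le_rfl)
  have j2 : ∀ x ∈ J ^ 2, x ∈ J := fun x hx => Ideal.pow_le_self two_ne_zero hx
  -- `J³/J⁴` and `J⁴` have only one nonzero element.
  have key3 : ∀ s ∈ J ^ 3, s ∉ J ^ 4 → ∀ t ∈ J ^ 3, t ∉ J ^ 4 → s - t ∈ J ^ 4 :=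
    fun s hs hs' t ht ht' => AddSubgroup.sub_mem_of_card_le_two_mul
      (A := (J ^ 4).toAddSubgroup) (B := (J ^ 3).toAddSubgroup)
      (Ideal.pow_le_pow_right (by norm_num)) hc3 hs ht hs' ht'
  have key4 : ∀ s ∈ J ^ 4, s ≠ 0 → ∀ t ∈ J ^ 4, t ≠ 0 → s = t := fun s hs hs' t ht ht' =>
    sub_eq_zero.1 (AddSubgroup.mem_bot.1 (AddSubgroup.sub_mem_of_card_le_two_mul (A := ⊥)
      (B := (J ^ 4).toAddSubgroup) bot_le (by simpa using hc4) hs ht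
      (by simpa using hs') (by simpa using ht')))
  have left3 : ∀ x ∈ J, ∀ s ∈ J ^ 3, ∀ t ∈ J ^ 3, s ∉ J ^ 4 → x * t ≠ 0 → x * s ≠ 0 := by
    intro x hx s hs t ht hs' hxt hxs
    have := z14 x hx _ (key3 s hs hs' t ht fun h => hxt (z14 x hx t h))
    rw [mul_sub, hxs, zero_sub, neg_eq_zero] at this
    exact hxt this
  have right3 : ∀ x ∈ J, ∀ s ∈ J ^ 3, ∀ t ∈ J ^ 3, s ∉ J ^ 4 → t * x ≠ 0 → s * x ≠ 0 := by
    intro x hx s hs t ht hs' hxt hxs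
    have := z41 _ (key3 s hs hs' t ht fun h => hxt (z41 t h x hx)) x hx
    rw [sub_mul, hxs, zero_sub, neg_eq_zero] at this
    exact hxt this
  -- An element `v` with `v⁴ ≠ 0`: the first factor of any nonzero product of four elements.
  obtain ⟨v, hv, hv4⟩ : ∃ v ∈ J, v * (v * v * v) ≠ 0 := by
    obtain ⟨w, hw, hw0⟩ := Submodule.exists_mem_ne_zero_of_ne_bot h4
    rw [Ideal.IsTwoSided.pow_succ] at hw
    obtain ⟨v, hv, t, ht, hvt⟩ := exists_mul_notMem (K := ⊥) hw (by simpa using hw0)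
    rw [Ideal.IsTwoSided.pow_succ] at ht
    obtain ⟨g, hg, r, hr, hgr⟩ := exists_mul_notMem (K := (AddMonoidHom.mulLeft v).ker) ht
      (by simpa using hvt)
    rw [Ideal.IsTwoSided.pow_succ, Submodule.pow_one] at hr
    obtain ⟨h, hh, q, hq, hhq⟩ := exists_mul_notMem
      (K := (AddMonoidHom.mulLeft (v * g)).ker) hr (by simpa [mul_assoc] using hgr)
    have e1 : v * g * h * q ≠ 0 := by simpa [mul_assoc] using hhq
    have e2 := left3 v hv (v * g * h) (m3 v hv g hg h hh) (g * h * q) (m3 g hg h hh q hq)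
      (fun e => e1 (z41 _ e q hq)) (by simpa [mul_assoc] using e1)
    have e3 := left3 v hv (v * v * g) (m3 v hv v hv g hg) (v * g * h) (m3 v hv g hg h hh)
      (fun e => e2 (by simpa [mul_assoc] using z41 _ e h hh)) e2
    exact ⟨v, hv, left3 v hv (v * v * v) (m3 v hv v hv v hv) (v * v * g) (m3 v hv v hv g hg)
      (fun e => e3 (by simpa [mul_assoc] using z41 _ e g hg)) e3⟩
  have hv3 : v * v * v ∉ J ^ 4 := fun h => hv4 (z14 v hv _ h)
  have vl : ∀ s ∈ J ^ 3, s ∉ J ^ 4 → v * s ≠ 0 := fun s hs hs' =>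
    left3 v hv s hs _ (m3 v hv v hv v hv) hs' hv4
  have vr : ∀ s ∈ J ^ 3, s ∉ J ^ 4 → s * v ≠ 0 := fun s hs hs' =>
    right3 v hv s hs _ (m3 v hv v hv v hv) hs' (by simpa [mul_assoc] using hv4)
  -- The kernel `Y` of the linear form `f` on `J/J²` for which the products of three or four
  -- elements of `J` are, modulo `J⁴` and `J⁵`, the products of the values of `f`.
  let Y : AddSubgroup R := J.toAddSubgroup ⊓ (AddMonoidHom.mulLeft (v * v * v)).ker
  have memY : ∀ x, x ∈ Y ↔ x ∈ J ∧ v * v * v * x = 0 := fun x => by simp [Y]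
  have YJ : ∀ x ∈ Y, x ∈ J := fun x hx => ((memY x).1 hx).1
  have hY1 : ∀ x ∈ Y, ∀ g ∈ J, ∀ h ∈ J, g * h * x ∈ J ^ 4 := by
    intro x hx g hg h hh
    obtain ⟨hxJ, hx0⟩ := (memY x).1 hx
    by_contra H
    have e1 := vl _ (m3 g hg h hh x hxJ) H
    exact right3 x hxJ (v * v * v) (m3 v hv v hv v hv) (v * g * h) (m3 v hv g hg h hh) hv3
      (by simpa [mul_assoc] using e1) hx0
  have hY2 : ∀ x ∈ Y, ∀ g ∈ J, ∀ h ∈ J, x * g * h ∈ J ^ 4 := by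
    intro x hx g hg h hh
    obtain ⟨hxJ, hx0⟩ := (memY x).1 hx
    by_contra H
    have e1 := vr _ (m3 x hxJ g hg h hh) H
    have e2 := left3 x hxJ (v * v * v) (m3 v hv v hv v hv) (g * h * v) (m3 g hg h hh v hv) hv3
      (by simpa [mul_assoc] using e1)
    have e3 := vl _ (m3 x hxJ v hv v hv)
      fun e => e2 (by simpa [mul_assoc] using z41 _ e v hv)
    have e4 := vl _ (m3 v hv x hxJ v hv)
      fun e => e3 (by simpa [mul_assoc] using z41 _ e v hv)
    have e5 := vl _ (m3 v hv v hv x hxJ)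
      fun e => e4 (by simpa [mul_assoc] using z41 _ e v hv)
    exact e5 (by simpa [mul_assoc] using hx0)
  have hY3 : ∀ x ∈ Y, ∀ g ∈ J, ∀ h ∈ J, g * x * h ∈ J ^ 4 := by
    intro x hx g hg h hh
    by_contra H
    have e1 := vr _ (m3 g hg x (YJ x hx) h hh) H
    exact e1 (by simpa [mul_assoc] using z14 g hg _ (hY2 x hx h hh v hv))
  have Y2r : ∀ x ∈ Y, ∀ t ∈ J ^ 2, x * t ∈ J ^ 4 := by
    intro x hx t ht
    by_contra H
    rw [Ideal.IsTwoSided.pow_succ, Submodule.pow_one] at ht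
    obtain ⟨g, hg, h, hh, H'⟩ := exists_mul_notMem
      (K := (J ^ 4).toAddSubgroup.comap (AddMonoidHom.mulLeft x)) ht (by simpa using H)
    exact H' (by simpa [mul_assoc] using hY2 x hx g hg h hh)
  have Y2l : ∀ x ∈ Y, ∀ t ∈ J ^ 2, t * x ∈ J ^ 4 := by
    intro x hx t ht
    by_contra H
    rw [Ideal.IsTwoSided.pow_succ, Submodule.pow_one] at ht
    obtain ⟨g, hg, h, hh, H'⟩ := exists_mul_notMem
      (K := (J ^ 4).toAddSubgroup.comap (AddMonoidHom.mulRight x)) ht (by simpa using H)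
    exact H' (by simpa [mul_assoc] using hY1 x hx g hg h hh)
  have Y3r : ∀ x ∈ Y, ∀ t ∈ J ^ 3, x * t = 0 := by
    intro x hx t ht
    by_contra H
    rw [Submodule.pow_succ] at ht
    obtain ⟨g, hg, h, hh, H'⟩ := exists_mul_notMem
      (K := (AddMonoidHom.mulLeft x).ker) ht (by simpa using H)
    exact H' (by simpa [mul_assoc] using z41 _ (Y2r x hx g hg) h hh)
  have Y3l : ∀ x ∈ Y, ∀ t ∈ J ^ 3, t * x = 0 := by
    intro x hx t ht
    by_contra H
    rw [Ideal.IsTwoSided.pow_succ] at ht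
    obtain ⟨g, hg, h, hh, H'⟩ := exists_mul_notMem
      (K := (AddMonoidHom.mulRight x).ker) ht (by simpa using H)
    exact H' (by simpa [mul_assoc] using z14 g hg _ (Y2l x hx h hh))
  have subY : ∀ x ∈ J, x ∉ Y → ∀ y ∈ J, y ∉ Y → x - y ∈ Y := by
    intro x hx hxY y hy hyY
    refine (memY _).2 ⟨J.sub_mem hx hy, ?_⟩
    rw [mul_sub, sub_eq_zero]
    exact key4 _ (m31 _ (m3 v hv v hv v hv) x hx) (fun e => hxY ((memY x).2 ⟨hx, e⟩))
      _ (m31 _ (m3 v hv v hv v hv) y hy) (fun e => hyY ((memY y).2 ⟨hy, e⟩))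
  have hvY : v ∉ Y := fun h => hv4 (by simpa [mul_assoc] using ((memY v).1 h).2)
  have J2Y : (J ^ 2).toAddSubgroup ≤ Y := fun x hx =>
    (memY x).2 ⟨j2 x hx, zero _ (mul_mem_ideal_pow (m3 v hv v hv v hv) hx le_rfl)⟩
  have YltJ : Y < J.toAddSubgroup := lt_of_le_of_ne (fun x hx => YJ x hx) fun h =>
    hvY (h ▸ (show v ∈ J.toAddSubgroup from hv))
  have hYcard := AddSubgroup.two_mul_card_le_of_lt YltJ
  have subJ2 : ∀ x ∈ Y, x ∉ J ^ 2 → ∀ y ∈ Y, y ∉ J ^ 2 → x - y ∈ J ^ 2 :=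
    fun x hx hx' y hy hy' => AddSubgroup.sub_mem_of_card_le_two_mul
      (A := (J ^ 2).toAddSubgroup) J2Y (by omega) hx hy hx' hy'
  have gen : ∀ p ∈ Y, p ∉ J ^ 2 → ∀ q ∈ J, q ∉ Y → ∀ x ∈ J,
      ∃ j ∈ J ^ 2, ∃ n m : ℤ, x = j + n • p + m • q := by
    intro p hp hp2 q hq hqY x hx
    have l1 := AddSubgroup.lt_sup_zmultiples (A := (J ^ 2).toAddSubgroup) hp2
    have l2 : (J ^ 2).toAddSubgroup ⊔ AddSubgroup.zmultiples p ≤ Y := sup_le J2Y (by simpa using hp)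
    have l3 := AddSubgroup.lt_sup_zmultiples fun h => hqY (l2 h)
    have l4 : (J ^ 2).toAddSubgroup ⊔ AddSubgroup.zmultiples p ⊔ AddSubgroup.zmultiples q ≤
        J.toAddSubgroup := sup_le (l2.trans YltJ.le) (by simpa using hq)
    have c1 := AddSubgroup.two_mul_card_le_of_lt l1
    have c2 := AddSubgroup.two_mul_card_le_of_lt l3
    have c3 : 0 < Nat.card (J ^ 2).toAddSubgroup := Nat.card_pos
    have l5 := l4.lt_or_eq.resolve_left fun h => by
      have := AddSubgroup.two_mul_card_le_of_lt h
      omega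
    obtain ⟨w, hw, m, rfl⟩ := AddSubgroup.exists_zsmul_of_mem_sup (l5.ge hx)
    obtain ⟨j, hj, n, rfl⟩ := AddSubgroup.exists_zsmul_of_mem_sup hw
    exact ⟨j, hj, n, m, rfl⟩
  by_cases haY : a ∈ Y
  · by_cases hbY : b ∈ Y
    · by_contra hne
      have haJ2 : a ∉ J ^ 2 := fun h => hne (Y3l b hbY _ (m21 a h c hc))
      have hbJ2 : b ∉ J ^ 2 := fun h => hne (by
        rw [mul_assoc]; exact Y3r a haY _ (m12 c hc b h))
      have hd := subJ2 b hbY hbJ2 a haY haJ2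
      have haca : a * c * a ≠ 0 := fun h => hne (by
        have e : a * c * b = a * (c * (b - a)) + a * c * a := by noncomm_ring
        rw [e, h, Y3r a haY _ (m12 c hc _ hd), zero_add])
      have haax : ∀ x ∈ J, a * a * x = 0 := fun x hx => by
        have e : a * a * x = a * b * x - a * (b - a) * x := by noncomm_ring
        rw [e, hab, zero_mul, zero_sub, neg_eq_zero]
        exact z41 _ (Y2r a haY _ hd) x hx
      have haya : ∀ y ∈ Y, a * y * a = 0 := fun y hy => by
        by_cases hy2 : y ∈ J ^ 2
        · rw [mul_assoc]; exact Y3r a haY _ (m21 y hy2 a ha)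
        · have e : a * y * a = a * ((y - a) * a) + a * a * a := by noncomm_ring
          rw [e, haax a ha, add_zero]
          exact Y3r a haY _ (m21 _ (subJ2 y hy hy2 a haY haJ2) a ha)
      have hava : a * v * a ≠ 0 := fun h => haca (by
        have hcY : c ∉ Y := fun hcY => haca (haya c hcY)
        have e : a * c * a = a * (c - v) * a + a * v * a := by noncomm_ring
        rw [e, h, haya _ (subY c hc hcY v hv hvY), add_zero])
      -- The elements `v²`, `va` and `av` of `J²` are linearly independent modulo `J³`, since they
      -- are told apart by multiplication by `v²` and by `a` from the left, and by `a` from the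
      -- right.
      let K1 : AddSubgroup R := (J ^ 2).toAddSubgroup ⊓ (AddMonoidHom.mulLeft (v * v)).ker
      let K2 : AddSubgroup R := K1 ⊓ (AddMonoidHom.mulLeft a).ker
      let K3 : AddSubgroup R := K2 ⊓ (AddMonoidHom.mulRight a).ker
      have l1 : K1 < (J ^ 2).toAddSubgroup := lt_of_le_of_ne inf_le_left fun h => by
        have : v * v ∈ K1 := h ▸ (show v * v ∈ (J ^ 2).toAddSubgroup from m2 v hv v hv)
        exact hv4 (by simpa [mul_assoc] using this.2)
      have l2 : K2 < K1 := lt_of_le_of_ne inf_le_left fun h => by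
        have h1 : v * a ∈ K1 := ⟨m2 v hv a ha, by simpa [mul_assoc] using ((memY a).1 haY).2⟩
        have : v * a ∈ K2 := h ▸ h1
        exact hava (by simpa [mul_assoc] using this.2)
      have l3 : K3 < K2 := lt_of_le_of_ne inf_le_left fun h => by
        have h1 : a * v ∈ K2 := ⟨⟨m2 a ha v hv, by
          simpa [mul_assoc] using z41 _ (hY1 a haY v hv v hv) v hv⟩, by
          simpa [mul_assoc] using haax v hv⟩
        have : a * v ∈ K3 := h ▸ h1
        exact hava (by simpa using this.2)
      have l4 : (J ^ 3).toAddSubgroup ≤ K3 := fun x hx => ⟨⟨⟨Ideal.pow_le_pow_right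
        (by norm_num) hx, z23 _ (m2 v hv v hv) x hx⟩, Y3r a haY x hx⟩, Y3l a haY x hx⟩
      have c1 := AddSubgroup.two_mul_card_le_of_lt l1
      have c2 := AddSubgroup.two_mul_card_le_of_lt l2
      have c3 := AddSubgroup.two_mul_card_le_of_lt l3
      have c4 := AddSubgroup.card_le_of_le l4
      have c5 : 0 < Nat.card (J ^ 3).toAddSubgroup := Nat.card_pos
      omega
    · -- Subtracting multiples of `a` and `b` from `c` does not change `a c b`.
      by_cases haJ2 : a ∈ J ^ 2
      · by_cases hcY : c ∈ Y
        · exact z41 _ (Y2l c hcY a haJ2) b hb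
        · have e : a * c * b = a * (c - b) * b + a * b * b := by noncomm_ring
          rw [e, hab, zero_mul, add_zero]
          exact z41 _ (Y2l _ (subY c hc hcY b hb hbY) a haJ2) b hb
      · obtain ⟨j, hj, n, m, rfl⟩ := gen a haY haJ2 b hb hbY c hc
        have e : a * (j + n • a + m • b) * b = a * j * b + n • (a * (a * b)) + m • (a * b * b) := by
          noncomm_ring
        rw [e, hab, z41 _ (Y2r a haY j hj) b hb]
        simp
  · by_cases hbY : b ∈ Y
    · by_cases hbJ2 : b ∈ J ^ 2
      · rw [mul_assoc]
        by_cases hcY : c ∈ Y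
        · exact z14 a ha _ (Y2r c hcY b hbJ2)
        · have e : a * (c * b) = a * ((c - a) * b) + a * (a * b) := by noncomm_ring
          rw [e, hab, mul_zero, add_zero]
          exact z14 a ha _ (Y2r _ (subY c hc hcY a ha haY) b hbJ2)
      · obtain ⟨j, hj, n, m, rfl⟩ := gen b hbY hbJ2 a ha haY c hc
        have e : a * (j + n • b + m • a) * b =
            a * (j * b) + n • (a * b * b) + m • (a * (a * b)) := by
          noncomm_ring
        rw [e, hab, z14 a ha _ (Y2l b hbY j hj)]
        simp
    · -- Here `a`, `b` and `v` are congruent modulo `Y`, so `a b v` and `v³` are congruent modulo `J⁴`.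
      exfalso
      have h1 := hY3 _ (subY b hb hbY v hv hvY) v hv v hv
      have h2 := hY2 _ (subY a ha haY v hv hvY) b hb v hv
      have e : v * v * v = a * b * v - v * (b - v) * v - (a - v) * b * v := by noncomm_ring
      apply hv3
      rw [e, hab, zero_mul, zero_sub]
      exact (J ^ 4).sub_mem ((J ^ 4).neg_mem h1) h2

/-! ### Finite local rings -/

theorem mem_jacobson_iff_not_isUnit {R : Type*} [Ring R] [IsLocalRing R] [Finite R] {x : R} :
    x ∈ Ring.jacobson R ↔ ¬ IsUnit x := by
  constructor
  · intro hx hu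
    have h1 : Ring.jacobson R = ⊤ := Ideal.eq_top_of_isUnit_mem _ hx hu
    obtain ⟨m, hm⟩ := Ideal.exists_maximal R
    exact hm.ne_top (top_le_iff.1 (h1 ▸ sInf_le hm.out))
  · -- The nonunits form a left ideal, so every maximal left ideal consists of all nonunits.
    intro hx
    let N : Ideal R :=
      { carrier := nonunits R
        add_mem' := IsLocalRing.nonunits_add
        zero_mem' := by simp
        smul_mem' := fun r y hy h => hy (isUnit_of_mul_isUnit_right h) }
    refine (Submodule.mem_sInf).2 fun m hm => ?_
    have hmN : m ≤ N := fun y hy hu => hm.1 (Ideal.eq_top_of_isUnit_mem _ hy hu)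
    have hN : N ≠ ⊤ := fun h => (h ▸ Submodule.mem_top : (1 : R) ∈ N) isUnit_one
    have : m = N := by
      by_contra hne
      exact hN (hm.2 _ (lt_of_le_of_ne hmN hne))
    rw [this]; exact hx

theorem exists_pow_isIdempotentElem {M : Type*} [Monoid M] [Finite M] (a : M) :
    ∃ n ≠ 0, IsIdempotentElem (a ^ n) := by
  obtain ⟨i, j, hij, h⟩ : ∃ i j : ℕ, i < j ∧ a ^ i = a ^ j := by
    obtain ⟨i, j, hne, h⟩ := Finite.exists_ne_map_eq_of_infinite (fun n : ℕ => a ^ n)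
    rcases hne.lt_or_gt with hlt | hlt
    exacts [⟨i, j, hlt, h⟩, ⟨j, i, hlt, h.symm⟩]
  obtain ⟨p, rfl⟩ := Nat.exists_eq_add_of_lt hij
  have period : ∀ k t, i ≤ t → a ^ (t + k * (p + 1)) = a ^ t := by
    intro k t ht
    obtain ⟨s, rfl⟩ := Nat.exists_eq_add_of_le ht
    induction k with
    | zero => simp
    | succ k ih =>
      rw [show i + s + (k + 1) * (p + 1) = i + p + 1 + (s + k * (p + 1)) by ring, pow_add, ← h,
        ← pow_add, ← add_assoc, ih]
  refine ⟨(i + 1) * (p + 1), by positivity, ?_⟩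
  rw [IsIdempotentElem, ← pow_add]
  exact period _ _ (by nlinarith)

/-- A finite ring without nontrivial idempotents is local, since every element has an idempotent
power. -/
theorem isLocalRing_of_idempotents_trivial {R : Type*} [Ring R] [Finite R] [Nontrivial R]
    (h : ∀ e : R, IsIdempotentElem e → e = 0 ∨ e = 1) : IsLocalRing R where
  isUnit_or_isUnit_of_add_one {a b} hab := by
    obtain ⟨n, hn, hidem⟩ := exists_pow_isIdempotentElem a
    rcases h _ hidem with h0 | h1
    · rw [← eq_sub_iff_add_eq'] at hab
      exact Or.inr (hab ▸ IsNilpotent.isUnit_one_sub ⟨n, h0⟩)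
    · exact Or.inl (.of_pow_eq_one h1 hn)

/-- Over a finite local ring with residue field of order `q`, a left ideal containing
`K` properly is larger than `K` by a factor of at least `q`. -/
theorem index_jacobson_mul_card_le {R : Type*} [Ring R] [IsLocalRing R] [Finite R]
    {K M : Ideal R} (hKM : K ≤ M) {x : R} (hxM : x ∈ M) (hxK : x ∉ K) :
    (Ring.jacobson R).toAddSubgroup.index * Nat.card K.toAddSubgroup ≤
      Nat.card M.toAddSubgroup := by
  set J := Ring.jacobson R with hJdef
  let ψ : R × K.toAddSubgroup →+ M.toAddSubgroup :=
    { toFun := fun p => ⟨p.1 * x + p.2, M.add_mem (M.mul_mem_left _ hxM) (hKM p.2.2)⟩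
      map_zero' := by ext; simp
      map_add' := fun p p' => by ext; simp [add_mul]; abel }
  have hker : Nat.card ψ.ker ≤ Nat.card J.toAddSubgroup := by
    have hmem : ∀ p : ψ.ker, p.1.1 ∈ J := fun p => by
      have hp : p.1.1 * x + p.1.2 = 0 := congrArg Subtype.val p.2
      rw [hJdef, mem_jacobson_iff_not_isUnit]
      rintro ⟨u, hu⟩
      apply hxK
      have : x = ↑u⁻¹ * -(p.1.2 : R) := by
        rw [← eq_neg_of_add_eq_zero_left hp, ← hu, Units.inv_mul_cancel_left]
      rw [this]
      exact K.mul_mem_left _ (K.neg_mem p.1.2.2)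
    refine Nat.card_le_card_of_injective (fun p => ⟨p.1.1, hmem p⟩) fun p p' hpp => ?_
    have h1 : p.1.1 = p'.1.1 := congrArg Subtype.val hpp
    have hp : p.1.1 * x + p.1.2 = 0 := congrArg Subtype.val p.2
    have hp' : p'.1.1 * x + p'.1.2 = 0 := congrArg Subtype.val p'.2
    rw [h1] at hp
    exact Subtype.ext (Prod.ext h1 (Subtype.ext (add_left_cancel (hp.trans hp'.symm))))
  have h1 := ψ.ker.card_mul_index
  have h2 : ψ.ker.index ≤ Nat.card M.toAddSubgroup := by
    rw [AddSubgroup.index_ker]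
    exact Nat.card_le_card_of_injective _ Subtype.val_injective
  have h3 := J.toAddSubgroup.card_mul_index
  rw [Nat.card_prod, ← h3, mul_assoc] at h1
  exact Nat.le_of_mul_le_mul_left (h1.symm.le.trans (Nat.mul_le_mul hker h2)) Nat.card_pos

/-- If the radical is generated by one element modulo its square, then `ab = 0` forces
`v(a) + v(b)` to be at least the nilpotency index, where `v` is the radical filtration. -/
theorem isSemicommutativeRing_of_jacobson_le_span_singleton {R : Type*} [Ring R] [IsLocalRing R]
    [Finite R] {x : R} (hxJ : x ∈ Ring.jacobson R)
    (hx : ∀ y ∈ Ring.jacobson R, ∃ r, y - r * x ∈ Ring.jacobson R ^ 2) :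
    IsSemicommutativeRing R := by
  set J := Ring.jacobson R with hJ
  have hnil : IsNilpotent J := IsSemiprimaryRing.isNilpotent
  have approx : ∀ k, ∀ y ∈ J ^ k, ∃ r, y - r * x ^ k ∈ J ^ (k + 1) := by
    intro k
    induction k with
    | zero => exact fun y _ => ⟨y, by simp⟩
    | succ k ih =>
      intro y hy
      rw [Submodule.pow_succ] at hy
      induction hy using Submodule.smul_induction_on' with
      | smul y hy z hz =>
        obtain ⟨s, hs⟩ := hx z hz
        obtain ⟨r, hr⟩ := ih (y * s) (Ideal.mul_mem_right _ _ hy)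
        refine ⟨r, ?_⟩
        have h1 := mul_mem_ideal_pow hr (mem_pow_one hxJ) (k := k + 1 + 1) le_rfl
        have h2 := mul_mem_ideal_pow hy hs (k := k + 1 + 1) le_rfl
        have e : y • z - r * x ^ (k + 1) = (y * s - r * x ^ k) * x + y * (z - s * x) := by
          rw [pow_succ, smul_eq_mul]; noncomm_ring
        rw [e]
        exact Ideal.add_mem _ h1 h2
      | add y _ z _ hy hz =>
        obtain ⟨r, hr⟩ := hy
        obtain ⟨s, hs⟩ := hz
        refine ⟨r + s, ?_⟩
        have e : y + z - (r + s) * x ^ (k + 1) =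
          y - r * x ^ (k + 1) + (z - s * x ^ (k + 1)) := by noncomm_ring
        rw [e]
        exact Ideal.add_mem _ hr hs
  have order : ∀ y ≠ 0, ∃ k, y ∈ J ^ k ∧ y ∉ J ^ (k + 1) := by
    intro y hy
    by_contra! H
    have all : ∀ k, y ∈ J ^ k := fun k => by
      induction k with
      | zero => rw [Submodule.pow_zero, Ideal.one_eq_top]; trivial
      | succ k ih => exact H k ih
    obtain ⟨N, hN⟩ := hnil
    have := all N
    rw [hN] at this
    exact hy this
  have lead : ∀ k, ∀ y ∈ J ^ k, ∀ r, x ^ k ∉ J ^ (k + 1) → y ∉ J ^ (k + 1) →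
      y - r * x ^ k ∈ J ^ (k + 1) → IsUnit r := by
    intro k y hy r hxk hyk h
    by_contra hr
    rw [← mem_jacobson_iff_not_isUnit, ← hJ] at hr
    have h1 := mul_mem_ideal_pow (mem_pow_one hr) (Ideal.pow_mem_pow hxJ k) (add_comm k 1).le
    exact hyk (by simpa using Ideal.add_mem _ h h1)
  have cancel : ∀ {u : R}, IsUnit u → ∀ {k : ℕ} {y : R}, u * y ∈ J ^ k → y ∈ J ^ k := by
    rintro _ ⟨u, rfl⟩ k y h
    simpa using Ideal.mul_mem_left (J ^ k) (↑u⁻¹ : R) h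
  intro a b hab t
  by_cases ha0 : a = 0
  · simp [ha0]
  by_cases hb0 : b = 0
  · simp [hb0]
  obtain ⟨i, hai, hai'⟩ := order a ha0
  obtain ⟨j, hbj, hbj'⟩ := order b hb0
  have hmem : a * t * b ∈ J ^ (i + j) :=
    mul_mem_ideal_pow (Ideal.mul_mem_right _ _ hai) hbj le_rfl
  suffices J ^ (i + j) = ⊥ by rwa [this] at hmem
  by_contra hne
  have hxij : x ^ (i + j) ∉ J ^ (i + j + 1) := fun h =>
    (pow_succ_lt_of_ne_bot hnil hne).not_ge fun y hy => by
      obtain ⟨r, hr⟩ := approx _ y hy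
      simpa using Ideal.add_mem _ hr (Ideal.mul_mem_left _ r h)
  have hxi : x ^ i ∉ J ^ (i + 1) := fun h => hxij (by
    rw [pow_add]; exact mul_mem_ideal_pow h (Ideal.pow_mem_pow hxJ j) (by omega))
  have hxj : x ^ j ∉ J ^ (j + 1) := fun h => hxij (by
    rw [pow_add]; exact mul_mem_ideal_pow (Ideal.pow_mem_pow hxJ i) h (by omega))
  obtain ⟨u, hu⟩ := approx i a hai
  obtain ⟨w, hw⟩ := approx j b hbj
  have huU := lead i a hai u hxi hai' hu
  have hwU := lead j b hbj w hxj hbj' hw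
  -- Moving the unit `w` to the left past `x ^ i` gives a unit `r`, up to higher order terms.
  have hxw : x ^ i * w ∈ J ^ i := Ideal.mul_mem_right _ _ (Ideal.pow_mem_pow hxJ i)
  obtain ⟨r, hr⟩ := approx i _ hxw
  have hrU := lead i _ hxw r hxi (fun h => hxi (by
    obtain ⟨w, rfl⟩ := hwU
    simpa [mul_assoc] using Ideal.mul_mem_right (↑w⁻¹ : R) (J ^ (i + 1)) h)) hr
  apply hxij
  apply cancel (huU.mul hrU)
  have e : u * r * x ^ (i + j) = a * b - a * (b - w * x ^ j) - (a - u * x ^ i) * w * x ^ j -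
      u * ((x ^ i * w - r * x ^ i) * x ^ j) := by
    rw [pow_add]; noncomm_ring
  rw [e, hab, zero_sub]
  refine Ideal.sub_mem _ (Ideal.sub_mem _ (Ideal.neg_mem_iff _ |>.2 ?_) ?_)
    (Ideal.mul_mem_left _ _ ?_)
  · exact mul_mem_ideal_pow hai hw (by omega)
  · exact mul_mem_ideal_pow (Ideal.mul_mem_right _ _ hu) (Ideal.pow_mem_pow hxJ j) (by omega)
  · exact mul_mem_ideal_pow hr (Ideal.pow_mem_pow hxJ j) (by omega)

/-- A two-dimensional layer: if one element does not generate `M` modulo `K`, the index of `K` in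
`M` is at least `q²`. -/
theorem index_jacobson_sq_mul_card_le {R : Type*} [Ring R] [IsLocalRing R] [Finite R]
    {K M : Ideal R} (hKM : K ≤ M) {x y : R} (hxM : x ∈ M) (hxK : x ∉ K) (hyM : y ∈ M)
    (hy : ∀ r : R, y - r * x ∉ K) :
    (Ring.jacobson R).toAddSubgroup.index ^ 2 * Nat.card K.toAddSubgroup ≤
      Nat.card M.toAddSubgroup := by
  have hle : K ⊔ Ideal.span {x} ≤ M := sup_le hKM ((Ideal.span_singleton_le_iff_mem M).2 hxM)
  have h1 := index_jacobson_mul_card_le (le_sup_left : K ≤ K ⊔ Ideal.span {x})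
    (Submodule.mem_sup_right (Ideal.mem_span_singleton_self x)) hxK
  have h2 := index_jacobson_mul_card_le hle hyM fun h => by
    obtain ⟨k, hk, z, hz, hkz⟩ := Submodule.mem_sup.1 h
    obtain ⟨r, rfl⟩ := Ideal.mem_span_singleton'.1 hz
    exact hy r (by rw [← hkz, add_sub_cancel_right]; exact hk)
  calc _ = (Ring.jacobson R).toAddSubgroup.index *
        ((Ring.jacobson R).toAddSubgroup.index * Nat.card K.toAddSubgroup) := by ring
    _ ≤ _ := (Nat.mul_le_mul_left _ h1).trans h2

/-! ### Reflexive rings with fewer than 256 elements -/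

/-- The sizes of the layers `Jᵏ/Jᵏ⁺¹` decide which of the preceding arguments applies. -/
theorem isSemicommutativeRing_of_isLocalRing {R : Type*} [Ring R] [IsLocalRing R] [Finite R]
    (hR : IsReflexiveRing R) (hcard : Nat.card R < 256) : IsSemicommutativeRing R := by
  set J := Ring.jacobson R with hJ
  have hnil : IsNilpotent J := IsSemiprimaryRing.isNilpotent
  have hlt : ∀ k, J ^ k ≠ ⊥ → J.toAddSubgroup.index * Nat.card (J ^ (k + 1)).toAddSubgroup ≤
      Nat.card (J ^ k).toAddSubgroup := fun k hk => by
    have hk := pow_succ_lt_of_ne_bot hnil hk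
    obtain ⟨x, hx, hx'⟩ := SetLike.exists_of_lt hk
    exact index_jacobson_mul_card_le hk.le hx hx'
  have hpos : ∀ k, 0 < Nat.card (J ^ k).toAddSubgroup := fun k => Nat.card_pos
  have hone : (1 : R) ∉ J := fun h => mem_jacobson_iff_not_isUnit.1 h isUnit_one
  have hindex := J.toAddSubgroup.card_mul_index
  have hq2 : 2 ≤ J.toAddSubgroup.index := by
    have h1 : J.toAddSubgroup.index ≠ 1 := fun h => hone
      ((AddSubgroup.index_eq_one.1 h).ge (AddSubgroup.mem_top 1))
    have h0 : J.toAddSubgroup.index ≠ 0 := AddSubgroup.index_ne_zero_of_finite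
    omega
  intro a b hab t
  by_cases haU : IsUnit a
  · simp [(haU.mul_right_eq_zero).1 hab]
  by_cases hbU : IsUnit b
  · simp [(hbU.mul_left_eq_zero).1 hab]
  have ha : a ∈ J := mem_jacobson_iff_not_isUnit.2 haU
  have hb : b ∈ J := mem_jacobson_iff_not_isUnit.2 hbU
  by_cases hJ2 : J ^ 2 = ⊥
  · have := mul_mem_ideal_pow (k := 2) (mem_pow_one (J.mul_mem_right t ha)) (mem_pow_one hb) le_rfl
    rwa [hJ2] at this
  by_cases hgen : ∃ x ∈ J, ∀ y ∈ J, ∃ r, y - r * x ∈ J ^ 2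
  · obtain ⟨x, hx, hgen⟩ := hgen
    exact isSemicommutativeRing_of_jacobson_le_span_singleton hx hgen a b hab t
  -- The layer `J/J²` has at least `q²` elements, so that `q⁴ ≤ |R|`.
  have d1 : J.toAddSubgroup.index ^ 2 * Nat.card (J ^ 2).toAddSubgroup ≤
      Nat.card J.toAddSubgroup := by
    push Not at hgen
    obtain ⟨x, hx, hx'⟩ := hgen 0 J.zero_mem
    obtain ⟨y, hy, hy'⟩ := hgen x hx
    exact index_jacobson_sq_mul_card_le (Ideal.pow_le_self two_ne_zero) hx
      (by simpa using hx' 0) hy hy'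
  have d2 := hlt 2 hJ2
  have hq3 : J.toAddSubgroup.index ≤ 3 := by
    by_contra! h
    have h3 := hpos 3
    have : 4 ^ 4 ≤ Nat.card R := calc
      4 ^ 4 ≤ J.toAddSubgroup.index ^ 4 := Nat.pow_le_pow_left h 4
      _ ≤ J.toAddSubgroup.index ^ 2 * (J.toAddSubgroup.index * Nat.card (J ^ 3).toAddSubgroup) *
          J.toAddSubgroup.index := by
        nlinarith [Nat.mul_le_mul_left (J.toAddSubgroup.index ^ 4) h3]
      _ ≤ Nat.card R := by
        rw [← hindex]
        exact Nat.mul_le_mul_right _ ((Nat.mul_le_mul_left _ d2).trans d1)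
    omega
  -- The residue field is a prime field.
  have hres : ∀ r : R, ∃ n : ℤ, r - n ∈ J := by
    have h1 := AddSubgroup.lt_sup_zmultiples (A := J.toAddSubgroup) hone
    have h2 := AddSubgroup.eq_of_lt_of_le_of_card_lt h1 le_top (by
      have : 0 < Nat.card J.toAddSubgroup := Nat.card_pos
      rw [AddSubgroup.card_top, ← hindex]
      nlinarith)
    intro r
    obtain ⟨z, hz, n, rfl⟩ := AddSubgroup.exists_zsmul_of_mem_sup (h2.ge (AddSubgroup.mem_top r))
    exact ⟨n, by simpa using hz⟩
  suffices key : ∀ c ∈ J, a * c * b = 0 by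
    obtain ⟨n, hn⟩ := hres t
    have e : a * t * b = a * (t - n) * b + n * (a * b) := by
      rw [mul_sub, ← (Int.cast_commute n a).eq]; noncomm_ring
    rw [e, key _ hn, hab, mul_zero, add_zero]
  intro c hc
  by_cases hJ3 : J ^ 3 = ⊥
  · have := mul_mem_ideal_pow (k := 3) (mul_mem_ideal_pow (k := 2) (mem_pow_one ha)
      (mem_pow_one hc) le_rfl) (mem_pow_one hb) le_rfl
    rwa [hJ3] at this
  by_cases hgen2 : ∀ u ∈ J ^ 2, u ∉ J ^ 3 → ∀ x ∈ J ^ 2, ∃ n : ℤ, x - n * u ∈ J ^ 3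
  · obtain ⟨v, hv, hsq⟩ := exists_sq_le_polynomials hnil hJ3 hgen2
    exact mul_mul_eq_zero_of_sq_le_polynomials hR hv hsq ha hb hc hab
  -- The layer `J²/J³` has at least `q²` elements, so that `q⁶ ≤ |R|`.
  have d2' : J.toAddSubgroup.index ^ 2 * Nat.card (J ^ 3).toAddSubgroup ≤
      Nat.card (J ^ 2).toAddSubgroup := by
    push Not at hgen2
    obtain ⟨u, hu, hu', x, hx, hx'⟩ := hgen2
    refine index_jacobson_sq_mul_card_le (Ideal.pow_le_pow_right (by norm_num)) hu hu' hx
      fun r hr => ?_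
    obtain ⟨n, hn⟩ := hres r
    have h := mul_mem_ideal_pow (mem_pow_one hn) hu (k := 3) le_rfl
    apply hx' n
    have e : x - n * u = x - r * u + (r - n) * u := by noncomm_ring
    rw [e]
    exact Ideal.add_mem _ hr h
  have d3 : _ * Nat.card (J ^ 4).toAddSubgroup ≤ _ := hlt 3 hJ3
  have h4 := hpos 4
  obtain hq | hq : J.toAddSubgroup.index = 3 ∨ J.toAddSubgroup.index = 2 := by omega
  · rw [hq] at hindex d1 d2' d3
    omega
  rw [hq] at hindex d1 d2' d3
  -- From here on all orders are powers of two, and the exponents leave few possibilities.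
  have htwo : (2 : R) ∈ J := by
    by_contra h2
    have := AddSubgroup.sub_mem_of_card_le_two_mul (A := J.toAddSubgroup) le_top
      (by rw [AddSubgroup.card_top]; omega) (AddSubgroup.mem_top 2) (AddSubgroup.mem_top 1) h2 hone
    exact hone (by rwa [show (2 : R) - 1 = 1 by norm_num] at this)
  obtain ⟨k, hk⟩ := card_eq_two_pow_of_isNilpotent_two (R := R) (by
    obtain ⟨N, hN⟩ := hnil
    exact ⟨N, by simpa [hN] using Ideal.pow_mem_pow htwo N⟩)
  have hpow : ∀ A : AddSubgroup R, ∃ e, Nat.card A = 2 ^ e := fun A => by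
    obtain ⟨e, -, he⟩ := (Nat.dvd_prime_pow Nat.prime_two).1 (hk ▸ A.card_addSubgroup_dvd_card)
    exact ⟨e, he⟩
  have hexp : ∀ {x y : ℕ}, 2 ^ x ≤ 2 ^ y → x ≤ y := fun h =>
    (Nat.pow_le_pow_iff_right (by norm_num)).1 h
  obtain ⟨e1, he1⟩ := hpow J.toAddSubgroup
  obtain ⟨e2, he2⟩ := hpow (J ^ 2).toAddSubgroup
  obtain ⟨e3, he3⟩ := hpow (J ^ 3).toAddSubgroup
  obtain ⟨e4, he4⟩ := hpow (J ^ 4).toAddSubgroup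
  rw [he1, hk] at hindex
  rw [he1, he2, ← pow_add] at d1
  rw [he2, he3, ← pow_add] at d2'
  rw [he3, he4, ← pow_succ'] at d3
  have i0 : k ≤ 7 := Nat.le_of_lt_succ ((Nat.pow_lt_pow_iff_right (by norm_num)).1
    ((hk ▸ hcard).trans_eq (by norm_num : 256 = 2 ^ 8)))
  have i1 : e1 + 1 = k := Nat.pow_right_injective le_rfl (by simpa [pow_succ] using hindex)
  have i2 := hexp d1
  have i3 := hexp d2'
  have i4 := hexp d3
  by_cases hJ4 : J ^ 4 = ⊥
  · refine mul_mul_eq_zero_of_pow_four_eq_bot hR hres hJ4 ?_ ha hb hc hab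
    obtain ⟨z, hz⟩ := hpow (sqRightAnnihilator J)
    suffices e1 < 3 + z by
      rw [he1, hz, show 8 = 2 ^ 3 by norm_num, ← pow_add]
      exact Nat.pow_lt_pow_right (by norm_num) this
    obtain h | h : e1 = e2 + 2 ∨ e1 = 6 ∧ e2 = 3 ∧ e3 = 1 := by omega
    · have hle : (J ^ 2).toAddSubgroup ≤ sqRightAnnihilator J := fun x hx =>
        ⟨Ideal.pow_le_self two_ne_zero hx, fun u hu => by
          have := mul_mem_ideal_pow (k := 4) hu hx le_rfl
          rwa [hJ4] at this⟩
      have := AddSubgroup.card_le_of_le hle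
      rw [he2, hz] at this
      have := hexp this
      omega
    · have := card_le_card_sq_mul_card_sqRightAnnihilator hJ4 (by
        rw [he2, he3, h.2.1, h.2.2]; norm_num)
      rw [he1, he3, hz, ← pow_mul, ← pow_add] at this
      have := hexp this
      omega
  · obtain ⟨e5, he5⟩ := hpow (J ^ 5).toAddSubgroup
    obtain ⟨e6, he6⟩ := hpow (J ^ 6).toAddSubgroup
    have d4 : _ * Nat.card (J ^ 5).toAddSubgroup ≤ _ := hlt 4 hJ4
    rw [hq, he4, he5, ← pow_succ'] at d4
    have i5 := hexp d4
    have hJ5 : J ^ 5 = ⊥ := by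
      by_contra h
      have d5 : _ * Nat.card (J ^ 6).toAddSubgroup ≤ _ := hlt 5 h
      rw [hq, he5, he6, ← pow_succ'] at d5
      have i6 := hexp d5
      omega
    obtain ⟨rfl, rfl, rfl, rfl⟩ : e1 = 6 ∧ e2 = 4 ∧ e3 = 2 ∧ e4 = 1 := by omega
    exact mul_mul_eq_zero_of_pow_five_eq_bot hJ5 hJ4 (by omega) (by omega) (by omega) (by omega)
      ha hb hc hab

/-- A central nontrivial idempotent `e` splits `R` into the smaller rings `eRe` and
`(1 - e)R(1 - e)`, which inherit both properties; without such idempotents `R` is local. -/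
theorem isSemicommutativeRing_of_card_lt {R : Type*} [Ring R] [Finite R]
    (hA : IsAbelianRing R) (hR : IsReflexiveRing R) (hcard : Nat.card R < 256) :
    IsSemicommutativeRing R := by
  induction hn : Nat.card R using Nat.strong_induction_on generalizing R with
  | _ n ih =>
  by_cases htriv : ∀ e : R, IsIdempotentElem e → e = 0 ∨ e = 1
  · cases subsingleton_or_nontrivial R
    · exact fun a b _ x => Subsingleton.elim _ _
    · have := isLocalRing_of_idempotents_trivial htriv
      exact isSemicommutativeRing_of_isLocalRing hR hcard
  push Not at htriv
  obtain ⟨e, he, he0, he1⟩ := htriv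
  have corner : ∀ f : R, IsIdempotentElem f → f ≠ 1 → ∀ a b : R, a * b = 0 → ∀ x,
      f * (a * x * b) = 0 := by
    intro f hf hf1 a b hab x
    have : Finite hf.Corner := inferInstanceAs (Finite (Subsemigroup.corner f))
    have hmem : ∀ r : hf.Corner, f * r.1 = r.1 ∧ r.1 * f = r.1 := fun r =>
      (Subsemigroup.mem_corner_iff hf).1 r.2
    have hlt : Nat.card hf.Corner < Nat.card R := by
      refine Finite.card_subtype_lt (x := (1 : R)) fun h => hf1 ?_
      simpa using ((Subsemigroup.mem_corner_iff hf).1 h).1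
    have hS : IsSemicommutativeRing hf.Corner := by
      refine ih _ (hn ▸ hlt) (fun g hg r => ?_) (fun r s hrs t => ?_) (hlt.trans hcard) rfl
      · exact Subtype.ext (hA g.1 (congrArg Subtype.val hg) r.1)
      · refine Subtype.ext (hR r.1 s.1 (fun y => ?_) t.1)
        have h := congrArg Subtype.val (hrs ⟨f * y * f, y, rfl⟩)
        change r.1 * (f * y * f) * s.1 = 0 at h
        rwa [← mul_assoc, ← mul_assoc, (hmem r).2, mul_assoc _ f, (hmem s).1] at h
    have key : ∀ r : R, f * r * f = f * r := fun r => by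
      rw [mul_assoc, ← hA f hf r, ← mul_assoc, hf.eq]
    have h := congrArg Subtype.val (hS ⟨f * a * f, a, rfl⟩ ⟨f * b * f, b, rfl⟩ (Subtype.ext (by
      change f * a * f * (f * b * f) = 0
      rw [key b, ← mul_assoc, key a, key a, mul_assoc, hab, mul_zero]))
      ⟨f * x * f, x, rfl⟩)
    change f * a * f * (f * x * f) * (f * b * f) = 0 at h
    rwa [key a, key x, key b, ← mul_assoc (f * a), key a, ← mul_assoc, mul_assoc f a, key,
      mul_assoc] at h
  intro a b hab x
  have h1 := corner e he he1 a b hab x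
  have h2 := corner (1 - e) he.one_sub (fun h => he0 (by simpa using h)) a b hab x
  rwa [sub_mul, h1, one_mul, sub_zero] at h2

/-! ### Group algebras -/

namespace MonoidAlgebra

theorem coeff_mul_one_comm {k G : Type*} [CommSemiring k] [Group G] (x y : MonoidAlgebra k G) :
    (x * y).coeff 1 = (y * x).coeff 1 := by
  classical
  induction x using MonoidAlgebra.induction_linear with
  | zero => simp
  | add x x' hx hx' => simp [add_mul, mul_add, hx, hx']
  | single g r =>
    rw [coeff_single_mul_apply, coeff_mul_single_apply, mul_one, one_mul, mul_comm]

/-- The coefficient of the identity is a nondegenerate symmetric trace, so a group algebra is a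
symmetric algebra. -/
theorem isReflexiveRing {k G : Type*} [CommRing k] [Group G] :
    IsReflexiveRing (MonoidAlgebra k G) := by
  intro a b hab x
  ext g
  have h1 : (single g⁻¹ (1 : k) * (b * x * a)).coeff 1 = (b * x * a).coeff g := by
    rw [coeff_single_mul_apply]; simp
  have h2 : a * (single g⁻¹ (1 : k) * (b * x)) = 0 := by
    rw [← mul_assoc, ← mul_assoc, hab, zero_mul]
  rw [← h1, ← mul_assoc, coeff_mul_one_comm, h2]
  simp

/-- An element of the group algebra of a finite `p`-group in characteristic `p` is a unit as soon
as its augmentation is nonzero: otherwise its left annihilator would contain a nonzero vector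
fixed by the group, which is a constant function and on which the element acts by its
augmentation. -/
theorem isUnit_of_augmentation_ne_zero {k G : Type*} [Field k] [Finite k] [Group G] [Finite G]
    {p : ℕ} [Fact p.Prime] [CharP k p] (hG : IsPGroup p G) {a : MonoidAlgebra k G}
    (ha : lift k k G 1 a ≠ 0) : IsUnit a := by
  have : Finite (MonoidAlgebra k G) := 
    Finite.of_injective (fun x : MonoidAlgebra k G => (x.coeff : G → k))
      (DFunLike.coe_injective.comp coeff_injective)
  let A : AddSubgroup (MonoidAlgebra k G) := (AddMonoidHom.mulRight a).ker
  have memA : ∀ m, m ∈ A ↔ m * a = 0 := fun m => Iff.rfl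
  suffices h : ∀ m ∈ A, m = 0 by
    have hinj : Function.Injective fun m => m * a := fun m m' h' =>
      sub_eq_zero.1 (h _ ((memA _).2 (by rw [sub_mul]; exact sub_eq_zero.2 h')))
    obtain ⟨b, hb⟩ := Finite.surjective_of_injective hinj 1
    exact IsUnit.of_mul_eq_one_right b hb
  let act : MulAction G A :=
    { smul := fun g m => ⟨single g 1 * m.1, (memA _).2 (by
        rw [mul_assoc, (memA _).1 m.2, mul_zero])⟩
      one_smul := fun m => Subtype.ext (one_mul m.1)
      mul_smul := fun g h m => Subtype.ext (by
        change single (g * h) 1 * m.1 = single g 1 * (single h 1 * m.1)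
        rw [← mul_assoc, single_mul_single, one_mul]) }
  by_contra! H
  obtain ⟨m, hm, hm0⟩ := H
  have hp : p ∣ Nat.card A := by
    have h1 : addOrderOf (⟨m, hm⟩ : A) = p := addOrderOf_eq_prime (Subtype.ext (by
      change p • m = 0
      rw [← Nat.cast_smul_eq_nsmul k, CharP.cast_eq_zero, zero_smul]))
      (fun h => hm0 (congrArg Subtype.val h))
    exact h1 ▸ addOrderOf_dvd_natCard _
  obtain ⟨n, hn, hn0⟩ := hG.exists_fixed_point_of_prime_dvd_card_of_fixed_point A hp
    (a := 0) (fun g => Subtype.ext (mul_zero _))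
  have hfix : ∀ g : G, single g 1 * n.1 = n.1 := fun g => congrArg Subtype.val (hn g)
  have hconst : ∀ g h : G, n.1.coeff g = n.1.coeff h := fun g h => by
    conv_rhs => rw [← hfix (h * g⁻¹)]
    rw [coeff_single_mul_apply]; simp
  have hscalar : ∀ x : MonoidAlgebra k G, n.1 * x = lift k k G 1 x • n.1 := by
    intro x
    induction x using MonoidAlgebra.induction_linear with
    | zero => simp
    | add x x' hx hx' => rw [mul_add, map_add, add_smul, hx, hx']
    | single g r =>
      ext h
      rw [coeff_mul_single_apply, coeff_smul_apply, hconst (h * g⁻¹) h]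
      simp [mul_comm]
  have h0 := hscalar a
  rw [(memA _).1 n.2, eq_comm, smul_eq_zero] at h0
  exact hn0 (Subtype.ext (h0.resolve_left ha).symm)

theorem isLocalRing_of_isPGroup {k G : Type*} [Field k] [Finite k] [Group G] [Finite G]
    {p : ℕ} [Fact p.Prime] [CharP k p] (hG : IsPGroup p G) :
    IsLocalRing (MonoidAlgebra k G) where
  isUnit_or_isUnit_of_add_one {a b} hab := by
    by_cases ha : lift k k G 1 a = 0
    · refine Or.inr (isUnit_of_augmentation_ne_zero hG (fun hb => ?_))
      have := congrArg (lift k k G 1) hab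
      rw [map_add, ha, hb, map_one] at this
      simp at this
    · exact Or.inl (isUnit_of_augmentation_ne_zero hG ha)

end MonoidAlgebra

theorem IsLocalRing.isAbelianRing {R : Type*} [Ring R] [IsLocalRing R] : IsAbelianRing R := by
  intro e he x
  have h : e * (1 - e) = 0 := by rw [mul_sub, he.eq, mul_one, sub_self]
  rcases IsLocalRing.isUnit_or_isUnit_of_add_one (add_sub_cancel e 1) with hu | hu
  · rw [← sub_eq_zero.1 (hu.mul_right_eq_zero.1 h)]; simp
  · rw [hu.mul_left_eq_zero.1 h]; simp

/-! ### The group algebra of the dihedral group of order eight -/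

theorem isLocalRing_F2D8 : IsLocalRing F2D8 :=
  MonoidAlgebra.isLocalRing_of_isPGroup (p := 2)
    (IsPGroup.of_card (n := 3) (by rw [DihedralGroup.nat_card]; norm_num))

/-- With `s` a reflection and `r` a rotation of order four, `(1 + s)² = 0` but
`(1 + s) r (1 + s) = r + sr + rs + srs ≠ 0`. -/
theorem not_isSemicommutativeRing_F2D8 : ¬ IsSemicommutativeRing F2D8 := by
  intro h
  let s : F2D8 := .single (.sr 0) 1
  let r : F2D8 := .single (.r 1) 1
  have hss : (1 + s) * (1 + s) = 0 := by
    have h1 : s * s = 1 := by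
      simp only [s, MonoidAlgebra.single_mul_single, MonoidAlgebra.one_def]
      rfl
    have h2 : s + s = 0 := by
      simp only [s, ← MonoidAlgebra.single_add]
      rw [show (1 + 1 : ZMod 2) = 0 from rfl, MonoidAlgebra.single_zero]
    have h3 : (1 : F2D8) + 1 = 0 := by
      simp only [MonoidAlgebra.one_def, ← MonoidAlgebra.single_add]
      rw [show (1 + 1 : ZMod 2) = 0 from rfl, MonoidAlgebra.single_zero]
    calc (1 + s) * (1 + s) = 1 + s * s + (s + s) := by noncomm_ring
      _ = 0 := by rw [h1, h2, h3, add_zero]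
  have h1 := congrArg (fun x => MonoidAlgebra.coeff x (DihedralGroup.r 1)) (h _ _ hss r)
  have e : (1 + s) * r * (1 + s) = r + s * r + r * s + s * r * s := by noncomm_ring
  rw [e] at h1
  simp only [s, r, MonoidAlgebra.single_mul_single, MonoidAlgebra.coeff_add,
    Finsupp.add_apply, MonoidAlgebra.coeff_single, Finsupp.single_apply, MonoidAlgebra.coeff_zero,
    Finsupp.zero_apply] at h1
  revert h1
  decide

theorem mk_F2D8 : Cardinal.mk F2D8 = 256 := by
  have h : Nat.card (DihedralGroup 4 →₀ ZMod 2) = 256 := by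
    rw [Nat.card_congr Finsupp.equivFunOnFinite, Nat.card_fun, DihedralGroup.nat_card]
    simp
  rw [Cardinal.mk_congr MonoidAlgebra.coeffEquiv, ← Nat.cast_card, h]
  norm_num

theorem isAbelianReflexiveNonsemicommutative_F2D8 :
    IsAbelianReflexiveNonsemicommutative F2D8 :=
  have := isLocalRing_F2D8
  ⟨IsLocalRing.isAbelianRing, MonoidAlgebra.isReflexiveRing, not_isSemicommutativeRing_F2D8⟩

theorem IsAbelianReflexiveNonsemicommutative.of_ringEquiv {R S : Type*} [Ring R] [Ring S]
    (f : R ≃+* S) (h : IsAbelianReflexiveNonsemicommutative R) :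
    IsAbelianReflexiveNonsemicommutative S := by
  obtain ⟨hA, hR, hS⟩ := h
  refine ⟨fun e he x => f.symm.injective ?_, fun a b hab x => f.symm.injective ?_, fun h => hS ?_⟩
  · rw [map_mul, map_mul]
    exact hA _ (he.map f.symm) _
  · rw [map_mul, map_mul, map_zero]
    refine hR _ _ (fun y => f.injective ?_) _
    simpa using hab (f y)
  · intro a b hab x
    apply f.injective
    simpa using h (f a) (f b) (by rw [← map_mul, hab, map_zero]) (f x)

theorem IsAbelianReflexiveNonsemicommutative.le_mk {R : Type*} [Ring R]
    (h : IsAbelianReflexiveNonsemicommutative R) : 256 ≤ Cardinal.mk R := by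
  cases finite_or_infinite R
  · by_contra! hlt
    rw [← Nat.cast_card] at hlt
    exact h.2.2 (isSemicommutativeRing_of_card_lt h.1 h.2.1 (by exact_mod_cast hlt))
  · exact (Cardinal.natCast_le_aleph0 (n := 256)).trans (Cardinal.aleph0_le_mk R)

theorem mainTheorem2 :
    (∀ (R : Type u) [Ring R],
      IsMinimalAbelianReflexiveNonsemicommutative.{u, v} R → Cardinal.mk R = 256) ∧
    IsMinimalAbelianReflexiveNonsemicommutative.{0, v} F2D8 ∧
    IsLocalRing F2D8 ∧
    Cardinal.mk F2D8 = 256 := by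
  refine ⟨fun R _ hR => le_antisymm ?_ hR.1.le_mk,
    ⟨isAbelianReflexiveNonsemicommutative_F2D8, fun S _ hS => ?_⟩, isLocalRing_F2D8, mk_F2D8⟩
  · -- `R` is compared with a copy of the group algebra in the universe of the competitors.
    have h := hR.2 (ULift.{v} F2D8)
      (isAbelianReflexiveNonsemicommutative_F2D8.of_ringEquiv ULift.ringEquiv.symm)
    rw [Cardinal.mk_uLift, mk_F2D8] at h
    simpa using h
  · rw [mk_F2D8]
    simpa using hS.le_mk
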